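/- **Definitions.** "Almost all $n$" means all but finitely many $n$. Let $S\subseteq\mathbb N$. For $n\in S$ let $\delta_S(n)=m-n$, where $m$ is the least element of $S$ larger than $n$, and $\delta_S(n)=\infty$ if there is no such $m$. For $n,t\in\mathbb N$ let $\gamma_S(n,t)$ be the number of $m\in S$ with $\delta_S(m)\ge t$ and $m+t<n$. For $\varepsilon>0$ the set $S$ is *$\varepsilon$-loose relative to $n$* if there is an integer $t\ge 1$ with $t\,\gamma_S(n,t)\ge\varepsilon n$ and $n^{\varepsilon}\le t\le n^{1-\varepsilon}$. For a binary word $w\in\{0,1\}^s$ let $T_w=\{m\in\mathbb N\mid \chi_S(m+i)=w(i)\text{ for all }0\le i<s\}$ be the set of occurrences of $w$ in the characteristic function $\chi_S$ of $S$. The set $S$ is *pseudoloose* if there is $\varepsilon>0$ such that for almost all $n$ there are $s\le n^{1-\varepsilon}$ and $w\in\{0,1\}^s$ such that $T_w$ is $\varepsilon$-loose relative to $n$. $S$ is *periodic with period $\omega$* on an interval $\Delta\subseteq\mathbb N$ if $x\in S\Leftrightarrow x+\omega\in S$ whenever $x,x+\omega\in\Delta$. For $n\in\mathbb N$, $f_S(n)$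 is the least $\ell\in\mathbb N$ such that for some $\omega$ with $0<\omega\le\ell$ the set $S$ is periodic with period $\omega$ on $\{i\in\mathbb N\mid \ell-\omega\le i\le n-(\ell-\omega)\}$, and $\omega_S(n)$ is the least $\omega\ge 1$ such that $S$ is periodic with period $\omega$ on $\{i\in\mathbb N\mid f_S(n)-\omega\le i\le n-(f_S(n)-\omega)\}$. Structures are finite and nonempty, and each carries a built-in linear order $\le$, given by a bijection of its domain with $\{0,\dots,n-1\}$. For a generalized quantifier $Q$, $\mathrm{FO}_\le(Q)$ is first-order logic with the symbol $\le$ for the built-in order and with the quantifier $Q$, which may be nested. The *cardinality quantifier* $\mathsf C_S$ is given by $\mathsf C_S x\,\psi(x)$ being true iff the number of elements satisfying $\psi$ is in $S$; the *Härtig quantifier* $\mathsf I$ is given by $\mathsf I\,x,y\,(\psi(x),\theta(y))$ being true iff $\psi$ and $\theta$ are satisfied by equally many elements. For logics $\mathcal L,\mathcal L^*$ we write $\mathcal L\le\mathcal L^*$ if every class of such structures (of any fixed vocabulary) definable by a sentence of $\mathcal L$ is definable by a sentence of $\mathcal L^*$. The quantifier $\mathsf I$ is *definable in* $\mathcal L$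 if the class of all $\{U,V\}$-structures ($U$, $V$ unary) with $|U|=|V|$ is definable by a sentence of $\mathcal L$. **Proposition.** Let $S\subseteq\mathbb N$ be pseudoloose. Then: 1. there are $k,\ell\in\mathbb N$ such that $k\cdot f_S(n)\cdot\omega_S(n)^{\ell}\ge n$ for almost all $n\in\mathbb N$; 2. $\mathrm{FO}_\le(\mathsf I)\le\mathrm{FO}_\le(\mathsf C_S)$; 3. the Härtig quantifier $\mathsf I$ is definable in $\mathrm{FO}_\le(\mathsf C_S)$. -/

import Mathlib

open Filter

universe u v w

namespace CardQuant

/-! ### Looseness and pseudolooseness -/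

/-- `δ_S(n)`: the distance from `n` to the next larger element of `S`, and `⊤` if there is none. -/
noncomputable def gap (S : Set ℕ) (n : ℕ) : ℕ∞ :=
  sInf {d : ℕ∞ | ∃ m ∈ S, n < m ∧ d = ((m - n : ℕ) : ℕ∞)}

/-- `γ_S(n,t)`: the number of `m ∈ S` with `δ_S(m) ≥ t` and `m + t < n`. -/
noncomputable def gapCount (S : Set ℕ) (n t : ℕ) : ℕ :=
  {m : ℕ | m ∈ S ∧ (t : ℕ∞) ≤ gap S m ∧ m + t < n}.ncard

/-- The set of occurrences of the finite binary word `word` in the infinite binary word `χ`. -/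
def occurrences (χ : ℕ → Bool) {s : ℕ} (word : Fin s → Bool) : Set ℕ :=
  {m : ℕ | ∀ i : Fin s, χ (m + i) = word i}

open Classical in
/-- The characteristic function of `S`. -/
noncomputable def charFun (S : Set ℕ) : ℕ → Bool := fun n => decide (n ∈ S)

/-- `S` is `ε`-loose relative to `n`. -/
def LooseRelativeTo (S : Set ℕ) (ε : ℝ) (n : ℕ) : Prop :=
  ∃ t : ℕ, 0 < t ∧ ε * (n : ℝ) ≤ (t : ℝ) * (gapCount S n t : ℝ) ∧
    (n : ℝ) ^ ε ≤ (t : ℝ) ∧ (t : ℝ) ≤ (n : ℝ) ^ (1 - ε)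

/-- `S` is pseudoloose. "Almost all `n`" means all but finitely many. -/
def Pseudoloose (S : Set ℕ) : Prop :=
  ∃ ε : ℝ, 0 < ε ∧ ∀ᶠ n : ℕ in atTop, ∃ (s : ℕ) (word : Fin s → Bool),
    (s : ℝ) ≤ (n : ℝ) ^ (1 - ε) ∧ LooseRelativeTo (occurrences (charFun S) word) ε n

/-! ### The functions `f_S` and `ω_S` measuring periodicity -/

/-- `S` is periodic on `Δ` with period `p`. -/
def PeriodicOnWith (S Δ : Set ℕ) (p : ℕ) : Prop :=
  ∀ x : ℕ, x ∈ Δ → x + p ∈ Δ → (x ∈ S ↔ x + p ∈ S)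

/-- The interval `{i ∈ ℕ | ℓ - p ≤ i ≤ n - (ℓ - p)}`, bounds computed in the integers. -/
def middleInterval (n ℓ p : ℕ) : Set ℕ :=
  {i : ℕ | (ℓ : ℤ) - (p : ℤ) ≤ (i : ℤ) ∧ (i : ℤ) ≤ (n : ℤ) - ((ℓ : ℤ) - (p : ℤ))}

/-- The set of `ℓ` whose least element is `f_S(n)`. -/
def periodicityBounds (S : Set ℕ) (n : ℕ) : Set ℕ :=
  {ℓ : ℕ | ∃ p : ℕ, 0 < p ∧ p ≤ ℓ ∧ PeriodicOnWith S (middleInterval n ℓ p) p}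

/-- The function `f_S`. -/
noncomputable def fFun (S : Set ℕ) (n : ℕ) : ℕ := sInf (periodicityBounds S n)

/-- The set of `p` whose least element is `ω_S(n)`. -/
def periodsAt (S : Set ℕ) (n : ℕ) : Set ℕ :=
  {p : ℕ | 0 < p ∧ PeriodicOnWith S (middleInterval n (fFun S n) p) p}

/-- The function `ω_S`. -/
noncomputable def omegaFun (S : Set ℕ) (n : ℕ) : ℕ := sInf (periodsAt S n)

theorem periodicityBounds_nonempty (S : Set ℕ) (n : ℕ) : (periodicityBounds S n).Nonempty := by
  refine ⟨n + 1, 1, Nat.one_pos, by omega, ?_⟩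
  intro x hx hx'
  simp only [middleInterval, Set.mem_ofPred_eq] at hx hx'
  push_cast at hx hx'
  omega

theorem periodsAt_nonempty (S : Set ℕ) (n : ℕ) : (periodsAt S n).Nonempty := by
  obtain ⟨p, hp, -, h⟩ := Nat.sInf_mem (periodicityBounds_nonempty S n)
  exact ⟨p, hp, h⟩

/-- The non-periodicity condition: `k · f_S(n) · ω_S(n)^ℓ ≥ n` for some `k`, `ℓ` and almost
all `n`. -/
def NonPeriodicityCondition (S : Set ℕ) : Prop :=
  ∃ k ℓ : ℕ, ∀ᶠ n : ℕ in atTop, n ≤ k * fFun S n * omegaFun S n ^ ℓ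

/-! ### Finite ordered structures -/

/-- A finite nonempty `L`-structure together with a bijection from its domain onto an initial
segment `{0, …, n-1}` of the natural numbers; the bijection provides the built-in linear order. -/
structure BrModel (L : FirstOrder.Language.{u, v}) where
  /-- The domain. -/
  carrier : Type w
  /-- The interpretation of the vocabulary. -/
  str : L.Structure carrier
  nonempty : Nonempty carrier
  /-- The number of elements. -/
  size : ℕ
  /-- The bijection that yields the built-in order. -/
  numbering : carrier ≃ Fin size

instance (L : FirstOrder.Language.{u, v}) (M : BrModel.{u, v, w} L) : L.Structure M.carrier := M.str

/-- The two structures are isomorphic by an isomorphism commuting with the numberings. -/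
def BrModel.Iso {L : FirstOrder.Language.{u, v}} (M N : BrModel.{u, v, w} L) : Prop :=
  ∃ h : L.Equiv M.carrier N.carrier,
    ∀ a : M.carrier, (M.numbering a : ℕ) = (N.numbering (h a) : ℕ)

/-- The structure with the same domain and numbering as `M` and with the relations `r` in a
relational vocabulary `τ`. -/
def BrModel.withRelations {L : FirstOrder.Language.{u, v}} (M : BrModel.{u, v, w} L)
    (τ : FirstOrder.Language.{0, 0}) [τ.IsRelational]
    (r : ∀ k : ℕ, τ.Relations k → (Fin k → M.carrier) → Prop) : BrModel.{0, 0, w} τ where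
  carrier := M.carrier
  str := { funMap := fun g => isEmptyElim g, RelMap := fun {k} R a => r k R a }
  nonempty := M.nonempty
  size := M.size
  numbering := M.numbering

/-! ### Generalized quantifiers -/

/-- A generalized quantifier of a finite relational vocabulary: a class of finite structures that
is closed under isomorphism. -/
structure BrQuantifier where
  /-- The vocabulary of the quantifier. -/
  vocab : FirstOrder.Language.{0, 0}
  relational : vocab.IsRelational
  finite : Finite (Σ k : ℕ, vocab.Relations k)
  /-- The defining class. -/
  K : Set (BrModel.{0, 0, w} vocab)
  closed : ∀ M N : BrModel.{0, 0, w} vocab, M.Iso N → M ∈ K → N ∈ K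

instance (Q : BrQuantifier.{w}) : Q.vocab.IsRelational := Q.relational

/-- Formulas of `FO_≤(Q)` in the vocabulary `L`, with free variables among `x_0, …, x_{n-1}`.
The constructor `quant` binds, for every `k`-ary symbol `R` of the vocabulary of `Q`, the last
`k` variables of the formula `ψ k R`. -/
inductive Formula (Q : BrQuantifier.{w}) (L : FirstOrder.Language.{u, v}) : ℕ → Type (max u v)
  | falsum {n : ℕ} : Formula Q L n
  | equal {n : ℕ} (t₁ t₂ : L.Term (Fin n)) : Formula Q L n
  | le {n : ℕ} (t₁ t₂ : L.Term (Fin n)) : Formula Q L n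
  | rel {n k : ℕ} (R : L.Relations k) (ts : Fin k → L.Term (Fin n)) : Formula Q L n
  | imp {n : ℕ} (φ ψ : Formula Q L n) : Formula Q L n
  | all {n : ℕ} (φ : Formula Q L (n + 1)) : Formula Q L n
  | quant {n : ℕ} (ψ : ∀ k : ℕ, Q.vocab.Relations k → Formula Q L (n + k)) : Formula Q L n

/-- Truth of a formula of `FO_≤(Q)` in a finite ordered structure under an assignment. -/
def Formula.Realize {Q : BrQuantifier.{w}} {L : FirstOrder.Language.{u, v}} (M : BrModel.{u, v, w} L) :
    ∀ {n : ℕ}, Formula Q L n → (Fin n → M.carrier) → Prop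
  | _, .falsum, _ => False
  | _, .equal t₁ t₂, e => t₁.realize e = t₂.realize e
  | _, .le t₁ t₂, e => M.numbering (t₁.realize e) ≤ M.numbering (t₂.realize e)
  | _, .rel R ts, e => FirstOrder.Language.Structure.RelMap R (fun i => (ts i).realize e)
  | _, .imp φ ψ, e => φ.Realize M e → ψ.Realize M e
  | _, .all φ, e => ∀ a : M.carrier, φ.Realize M (Fin.snoc e a)
  | _, .quant ψ, e =>
      M.withRelations Q.vocab (fun k R a => (ψ k R).Realize M (Fin.append e a)) ∈ Q.K

/-- The class `C` of finite ordered `L`-structures is definable by a sentence of `FO_≤(Q)`. -/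
def DefinableIn (Q : BrQuantifier.{w}) {L : FirstOrder.Language.{u, v}} (C : Set (BrModel.{u, v, w} L)) :
    Prop :=
  ∃ φ : Formula Q L 0, ∀ M : BrModel.{u, v, w} L, M ∈ C ↔ φ.Realize M Fin.elim0

/-- `FO_≤(Q₁) ≤ FO_≤(Q₂)`: every class of finite ordered structures, of any vocabulary, that is
definable in `FO_≤(Q₁)` is definable in `FO_≤(Q₂)`. -/
def AtMostAsStrong (Q₁ Q₂ : BrQuantifier.{w}) : Prop :=
  ∀ (L : FirstOrder.Language.{u, v}) (C : Set (BrModel.{u, v, w} L)), DefinableIn Q₁ C → DefinableIn Q₂ C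

/-- The quantifier `Q₁` is definable in `FO_≤(Q₂)`. -/
def QuantifierDefinableIn (Q₁ Q₂ : BrQuantifier.{w}) : Prop := DefinableIn Q₂ Q₁.K

/-! ### Cardinality quantifiers and the Härtig quantifier -/

/-- The extension of a unary relation symbol. -/
def BrModel.ext {L : FirstOrder.Language.{u, v}} (M : BrModel.{u, v, w} L) (R : L.Relations 1) :
    Set M.carrier :=
  {a | FirstOrder.Language.Structure.RelMap R ![a]}

theorem BrModel.Iso.ncard_ext {L : FirstOrder.Language.{u, v}} {M N : BrModel.{u, v, w} L} (h : M.Iso N)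
    (R : L.Relations 1) : (M.ext R).ncard = (N.ext R).ncard := by
  obtain ⟨g, -⟩ := h
  have key : ∀ a, a ∈ M.ext R ↔ g a ∈ N.ext R := by
    intro a
    have h1 := g.map_rel R ![a]
    have h2 : (g ∘ ![a] : Fin 1 → N.carrier) = ![g a] := by
      funext i
      fin_cases i
      rfl
    rw [h2] at h1
    exact h1.symm
  have himg : g '' (M.ext R) = N.ext R := by
    ext b
    constructor
    · rintro ⟨a, ha, rfl⟩
      exact (key a).1 ha
    · intro hb
      refine ⟨g.symm b, (key _).2 ?_, g.apply_symm_apply b⟩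
      rwa [g.apply_symm_apply b]
  rw [← himg, Set.ncard_image_of_injective _ g.injective]

/-- The vocabulary `{U}` with `U` unary. -/
inductive CardRel : ℕ → Type
  | U : CardRel 1

/-- The vocabulary `{U, V}` with `U`, `V` unary. -/
inductive HartigRel : ℕ → Type
  | U : HartigRel 1
  | V : HartigRel 1

/-- The language `{U}`. -/
def cardVocab : FirstOrder.Language.{0, 0} := ⟨fun _ => Empty, CardRel⟩

/-- The language `{U, V}`. -/
def hartigVocab : FirstOrder.Language.{0, 0} := ⟨fun _ => Empty, HartigRel⟩

/-- The cardinality quantifier `C_S`: the size of `U` is in `S`. -/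
def cardinalityQuantifier (S : Set ℕ) : BrQuantifier.{w} where
  vocab := cardVocab
  relational := fun _ => inferInstanceAs (IsEmpty Empty)
  finite := by
    refine Finite.of_surjective (fun _ : Unit => (⟨1, CardRel.U⟩ : Σ k, CardRel k)) ?_
    rintro ⟨_, ⟨⟩⟩
    exact ⟨(), rfl⟩
  K := {M | (M.ext (L := cardVocab) CardRel.U).ncard ∈ S}
  closed := by
    intro M N h hM
    have e := h.ncard_ext (L := cardVocab) CardRel.U
    rw [Set.mem_ofPred_eq] at hM ⊢
    exact e ▸ hM

/-- The Härtig quantifier `I`: `U` and `V` have the same size. -/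
def hartigQuantifier : BrQuantifier.{w} where
  vocab := hartigVocab
  relational := fun _ => inferInstanceAs (IsEmpty Empty)
  finite := by
    refine Finite.of_surjective (fun b : Bool =>
      (bif b then ⟨1, HartigRel.U⟩ else ⟨1, HartigRel.V⟩ : Σ k, HartigRel k)) ?_
    rintro ⟨_, ⟨⟩⟩
    exacts [⟨true, rfl⟩, ⟨false, rfl⟩]
  K := {M | (M.ext (L := hartigVocab) HartigRel.U).ncard =
    (M.ext (L := hartigVocab) HartigRel.V).ncard}
  closed := by
    intro M N h hM
    have e₁ := h.ncard_ext (L := hartigVocab) HartigRel.U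
    have e₂ := h.ncard_ext (L := hartigVocab) HartigRel.V
    rw [Set.mem_ofPred_eq] at hM ⊢
    exact e₁.symm.trans (hM.trans e₂)

end CardQuant

/-! Fix `n` and write `f`, `ω` for `fFun S n`, `omegaFun S n`, and `d = f - ω`. On `[d, n - d]` the
set `S` has period `ω`, so an occurrence of a word lying well inside that interval recurs `ω` later.
Hence gaps of length `t > ω` start only near the two ends, and since such starting points are
`t`-separated there are few of them (`le_omegaFun_or_mul_gapCount_le`). Looseness then forces either
`ω ≥ t ≥ n ^ ε` or `f` linear in `n`; both give the non-periodicity condition.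

That condition alone yields definability of equicardinality. By minimality of `f`, two sizes below
`f` are equal iff they are `Interchangeable`, which can be tested by adding common outside elements
and asking whether the size is in `S`. By minimality of `ω` and Fine–Wilf, a size `r ≥ d` with `r +
f ≤ n` is interchangeable with `d` iff `ω ∣ r - d`. The first fact compares sets of size up to `f`,
through an explicit bijection that matches equal ranks (`swapRel`). The second singles out the
elements of a set at ranks `d, d + ω, d + 2ω, …`; a rank is then described by a number of such marks
and a remainder, so a comparison valid up to `g ≥ f` extends to one valid up to `g * ω`, as long as
sets stay within half of the domain (`blockRel`). Cutting sets in two doubles the range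
(`splitRel`). As `n ≤ k * f * ω ^ ℓ`, a number of steps independent of the structure suffices, so
one formula results. Each step is sound for every choice of its parameters, so the parameters may
simply be quantified existentially. -/

namespace CardQuant

/-! ### Definable families of predicates -/

section Definability

variable {Q : BrQuantifier.{w}} {L : FirstOrder.Language.{u, v}}

/-- The formula obtained by renaming the free variables along `σ`. -/
def Formula.relabel : ∀ {n m : ℕ}, (Fin n → Fin m) → Formula Q L n → Formula Q L m
  | _, _, _, .falsum => .falsum
  | _, _, σ, .equal t₁ t₂ => .equal (t₁.relabel σ) (t₂.relabel σ)
  | _, _, σ, .le t₁ t₂ => .le (t₁.relabel σ) (t₂.relabel σ)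
  | _, _, σ, .rel R ts => .rel R (fun i => (ts i).relabel σ)
  | _, _, σ, .imp φ ψ => .imp (φ.relabel σ) (ψ.relabel σ)
  | _, m, σ, .all φ => .all (φ.relabel (Fin.snoc (fun i => (σ i).castSucc) (Fin.last m)))
  | _, m, σ, .quant ψ =>
      .quant (fun k R => (ψ k R).relabel
        (Fin.append (fun i => (σ i).castAdd k) (fun i => Fin.natAdd m i)))

theorem Formula.realize_relabel (M : BrModel.{u, v, w} L) {n : ℕ} (φ : Formula Q L n) :
    ∀ {m : ℕ} (σ : Fin n → Fin m) (e : Fin m → M.carrier),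
      (φ.relabel σ).Realize M e ↔ φ.Realize M (fun i => e (σ i)) := by
  induction φ with
  | falsum => intros; rfl
  | equal t₁ t₂ =>
    intro m σ e
    simp only [Formula.relabel, Formula.Realize, FirstOrder.Language.Term.realize_relabel]
    rfl
  | le t₁ t₂ =>
    intro m σ e
    simp only [Formula.relabel, Formula.Realize, FirstOrder.Language.Term.realize_relabel]
    rfl
  | rel R ts =>
    intro m σ e
    simp only [Formula.relabel, Formula.Realize, FirstOrder.Language.Term.realize_relabel]
    rfl
  | imp φ ψ ihφ ihψ =>
    intro m σ e
    simp only [Formula.relabel, Formula.Realize, ihφ, ihψ]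
  | all φ ih =>
    intro m σ e
    simp only [Formula.relabel, Formula.Realize, ih]
    refine forall_congr' fun a => ?_
    have : (fun i => (Fin.snoc e a : Fin (m + 1) → M.carrier)
        ((Fin.snoc (fun i => (σ i).castSucc) (Fin.last m) : Fin _ → Fin (m + 1)) i)) =
        (Fin.snoc (fun i => e (σ i)) a : Fin _ → M.carrier) := by
      funext i
      refine Fin.lastCases ?_ (fun i => ?_) i <;> simp
    rw [this]
  | quant ψ ih =>
    intro m σ e
    simp only [Formula.relabel, Formula.Realize, ih]
    have : ∀ (k : ℕ) (a : Fin k → M.carrier), (fun i => Fin.append e a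
        (Fin.append (fun i => (σ i).castAdd k) (fun i => Fin.natAdd m i) i)) =
        Fin.append (fun i => e (σ i)) a := by
      intro k a
      funext i
      refine Fin.addCases (fun i => ?_) (fun i => ?_) i <;> simp
    simp only [this]

variable (Q) in
/-- The family `P` of predicates on assignments is defined by a formula of `FO_≤(Q)`. -/
def Dfn {n : ℕ} (P : ∀ M : BrModel.{u, v, w} L, (Fin n → M.carrier) → Prop) : Prop :=
  ∃ φ : Formula Q L n, ∀ M e, P M e ↔ φ.Realize M e

variable (Q) in
/-- The family `A` of predicates on domains, depending on an assignment, is definable. -/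
def DfnSet {n : ℕ} (A : ∀ M : BrModel.{u, v, w} L, (Fin n → M.carrier) → M.carrier → Prop) :
    Prop :=
  Dfn Q (n := n + 1) fun M e => A M (fun i => e i.castSucc) (e (Fin.last n))

/-! ### Closure of definable predicates under first-order operations -/

namespace Dfn

variable {n : ℕ} {P P' : ∀ M : BrModel.{u, v, w} L, (Fin n → M.carrier) → Prop}
  {A : ∀ M : BrModel.{u, v, w} L, (Fin n → M.carrier) → M.carrier → Prop}

theorem imp (h : Dfn Q P) (h' : Dfn Q P') : Dfn Q fun M e => P M e → P' M e := by
  obtain ⟨φ, hφ⟩ := h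
  obtain ⟨ψ, hψ⟩ := h'
  exact ⟨.imp φ ψ, fun M e => by simp only [Formula.Realize, hφ, hψ]⟩

theorem falsum : Dfn Q fun (M : BrModel.{u, v, w} L) (_ : Fin n → M.carrier) => False :=
  ⟨.falsum, fun M e => by simp only [Formula.Realize]⟩

theorem not (h : Dfn Q P) : Dfn Q fun M e => ¬ P M e := h.imp falsum

theorem congr (h : Dfn Q P) (hP : ∀ M e, P' M e ↔ P M e) : Dfn Q P' := by
  obtain ⟨φ, hφ⟩ := h
  exact ⟨φ, fun M e => (hP M e).trans (hφ M e)⟩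

theorem and (h : Dfn Q P) (h' : Dfn Q P') : Dfn Q fun M e => P M e ∧ P' M e :=
  (h.imp h'.not).not.congr fun M e => by tauto

theorem or (h : Dfn Q P) (h' : Dfn Q P') : Dfn Q fun M e => P M e ∨ P' M e :=
  (h.not.imp h').congr fun M e => by tauto

theorem iff (h : Dfn Q P) (h' : Dfn Q P') : Dfn Q fun M e => P M e ↔ P' M e :=
  ((h.imp h').and (h'.imp h)).congr fun M e => by tauto

theorem all (h : DfnSet Q A) : Dfn Q fun M e => ∀ a, A M e a := by
  obtain ⟨φ, hφ⟩ := h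
  refine ⟨.all φ, fun M e => ?_⟩
  simp only [Formula.Realize, ← hφ, Fin.snoc_castSucc, Fin.snoc_last]

theorem ex (h : DfnSet Q A) : Dfn Q fun M e => ∃ a, A M e a :=
  (all (A := fun M e a => ¬ A M e a) (Dfn.not h)).not.congr fun M e => by push Not; rfl

theorem equal (i j : Fin n) :
    Dfn Q fun (M : BrModel.{u, v, w} L) (e : Fin n → M.carrier) => e i = e j :=
  ⟨.equal (.var i) (.var j), fun M e => by simp [Formula.Realize]⟩

theorem numbering_le (i j : Fin n) :
    Dfn Q fun (M : BrModel.{u, v, w} L) (e : Fin n → M.carrier) =>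
      M.numbering (e i) ≤ M.numbering (e j) :=
  ⟨.le (.var i) (.var j), fun M e => by simp [Formula.Realize]⟩

/-- Lets a definable set with parameters be used under further quantifiers: `σ` locates its
parameters in the larger assignment and `j` the element tested. With it, the definability proofs
below follow the shape of the defined predicate and need no explicit formulas. -/
theorem subst (h : DfnSet Q A) {m : ℕ} (σ : Fin n → Fin m) (j : Fin m) :
    Dfn Q fun (M : BrModel.{u, v, w} L) (e : Fin m → M.carrier) =>
      A M (fun i => e (σ i)) (e j) := by
  obtain ⟨φ, hφ⟩ := h
  refine ⟨φ.relabel (Fin.snoc σ j), fun M e => ?_⟩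
  simp only [Formula.realize_relabel, ← hφ, Fin.snoc_castSucc, Fin.snoc_last]

end Dfn

/-! ### Semantics of the two quantifiers and the built-in order -/

theorem realize_cardinalityQuantifier {S : Set ℕ} (M : BrModel.{u, v, w} L) {n : ℕ}
    (ψ : ∀ k : ℕ, (cardinalityQuantifier.{w} S).vocab.Relations k →
      Formula (cardinalityQuantifier.{w} S) L (n + k)) (e : Fin n → M.carrier) :
    (Formula.quant ψ).Realize M e ↔
      {a | (ψ 1 CardRel.U).Realize M (Fin.snoc e a)}.ncard ∈ S := by
  have : ∀ a : M.carrier, Fin.append e ![a] = (Fin.snoc e a : Fin (n + 1) → M.carrier) := by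
    intro a
    rw [Fin.append_right_eq_snoc]
    rfl
  simp only [← this]
  rfl

theorem realize_hartigQuantifier (M : BrModel.{u, v, w} L) {n : ℕ}
    (ψ : ∀ k : ℕ, (hartigQuantifier.{w}).vocab.Relations k →
      Formula (hartigQuantifier.{w}) L (n + k)) (e : Fin n → M.carrier) :
    (Formula.quant ψ).Realize M e ↔
      {a | (ψ 1 HartigRel.U).Realize M (Fin.snoc e a)}.ncard =
        {a | (ψ 1 HartigRel.V).Realize M (Fin.snoc e a)}.ncard := by
  have : ∀ a : M.carrier, Fin.append e ![a] = (Fin.snoc e a : Fin (n + 1) → M.carrier) := by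
    intro a
    rw [Fin.append_right_eq_snoc]
    rfl
  simp only [← this]
  rfl

theorem Dfn.ncard_mem {S : Set ℕ} {n : ℕ}
    {A : ∀ M : BrModel.{u, v, w} L, (Fin n → M.carrier) → M.carrier → Prop}
    (h : DfnSet (cardinalityQuantifier.{w} S) A) :
    Dfn (cardinalityQuantifier.{w} S) fun M e => {a | A M e a}.ncard ∈ S := by
  obtain ⟨φ, hφ⟩ := h
  refine ⟨.quant fun k R => match k, R with | _, CardRel.U => φ, fun M e => ?_⟩
  rw [realize_cardinalityQuantifier]
  simp only [← hφ, Fin.snoc_castSucc, Fin.snoc_last]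

/-- The built-in linear order. -/
noncomputable instance (M : BrModel.{u, v, w} L) : LinearOrder M.carrier :=
  LinearOrder.lift' M.numbering M.numbering.injective

instance (M : BrModel.{u, v, w} L) : Finite M.carrier := Finite.of_equiv _ M.numbering.symm

instance (M : BrModel.{u, v, w} L) : Nonempty M.carrier := M.nonempty

theorem Dfn.le {n : ℕ} (i j : Fin n) :
    Dfn Q fun (M : BrModel.{u, v, w} L) (e : Fin n → M.carrier) => e i ≤ e j :=
  Dfn.numbering_le i j

theorem Dfn.lt {n : ℕ} (i j : Fin n) :
    Dfn Q fun (M : BrModel.{u, v, w} L) (e : Fin n → M.carrier) => e i < e j :=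
  (Dfn.le j i).not.congr fun _ _ => not_le.symm

end Definability

/-! ### Periods of a set of natural numbers -/

section Periodicity

variable {S : Set ℕ}

theorem omegaFun_mem (S : Set ℕ) (n : ℕ) : omegaFun S n ∈ periodsAt S n :=
  Nat.sInf_mem (periodsAt_nonempty S n)

theorem omegaFun_pos (S : Set ℕ) (n : ℕ) : 0 < omegaFun S n := (omegaFun_mem S n).1

theorem omegaFun_le_fFun (S : Set ℕ) (n : ℕ) : omegaFun S n ≤ fFun S n := by
  obtain ⟨p, hp, hpf, h⟩ := Nat.sInf_mem (periodicityBounds_nonempty S n)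
  exact (Nat.sInf_le ⟨hp, h⟩ : omegaFun S n ≤ p).trans hpf

theorem fFun_pos (S : Set ℕ) (n : ℕ) : 0 < fFun S n :=
  (omegaFun_pos S n).trans_le (omegaFun_le_fFun S n)

/-- `S` is periodic with period `p` on the interval `[lo, hi]`. -/
def PeriodicIcc (S : Set ℕ) (lo hi p : ℕ) : Prop :=
  ∀ x, lo ≤ x → x + p ≤ hi → (x ∈ S ↔ x + p ∈ S)

theorem periodicIcc_omegaFun (S : Set ℕ) (n : ℕ) :
    PeriodicIcc S (fFun S n - omegaFun S n) (n - (fFun S n - omegaFun S n)) (omegaFun S n) := by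
  intro x hx hx'
  have h := (omegaFun_mem S n).2
  have := omegaFun_le_fFun S n
  have := omegaFun_pos S n
  apply h x <;> simp only [middleInterval, Set.mem_ofPred_eq] <;> omega

/-- The interval on which a period is tested shrinks as the period gets smaller, so for `h ≤
omegaFun S n` periodicity on the larger interval is enough to make `h` a competitor in the minimum.
-/
theorem omegaFun_le {n h : ℕ} (h0 : 0 < h) (hh : h ≤ omegaFun S n)
    (hS : PeriodicIcc S (fFun S n - omegaFun S n) (n - (fFun S n - omegaFun S n)) h) :
    omegaFun S n ≤ h := by
  refine Nat.sInf_le ⟨h0, fun x hx hx' => hS x ?_ ?_⟩ <;>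
  · simp only [middleInterval, Set.mem_ofPred_eq] at hx hx'
    have := omegaFun_le_fFun S n
    omega

/-- Otherwise `b - a` would be a period of `S` on `[a, n - a]`, making `b` an admissible bound
smaller than the minimum `fFun S n`. -/
theorem exists_not_iff_of_lt_fFun {n a b : ℕ} (hab : a < b) (hb : b < fFun S n) :
    ∃ c, a + b + c ≤ n ∧ ¬ (a + c ∈ S ↔ b + c ∈ S) := by
  by_contra! hcon
  refine Nat.notMem_of_lt_sInf hb ⟨b - a, by omega, by omega, fun x hx hx' => ?_⟩
  simp only [middleInterval, Set.mem_ofPred_eq] at hx hx'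
  obtain ⟨c, rfl⟩ : ∃ c, x = a + c := ⟨x - a, by omega⟩
  have := hcon c (by omega)
  rwa [show b + c = a + c + (b - a) by omega] at this

theorem PeriodicIcc.mul {lo hi p : ℕ} (h : PeriodicIcc S lo hi p) (k : ℕ) :
    PeriodicIcc S lo hi (p * k) := by
  induction k with
  | zero => intro x _ _; simp
  | succ k ih =>
    intro x hx hx'
    rw [mul_add, mul_one, ← add_assoc] at *
    exact (ih x hx (by omega)).trans (h _ (by omega) hx')

theorem PeriodicIcc.sub {lo hi p q : ℕ} (hp : PeriodicIcc S lo hi p) (hq : PeriodicIcc S lo hi q)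
    (hpq : p ≤ q) (hlen : lo + p + q ≤ hi) : PeriodicIcc S lo hi (q - p) := by
  intro x hx hx'
  -- With room below, step down by `p` and up by `q`; otherwise step up by `q` and down by `p`,
  -- where `hlen` keeps `x + q` within the interval.
  by_cases hxp : lo + p ≤ x
  · have h1 := hp (x - p) (by omega) (by omega)
    have h2 := hq (x - p) (by omega) (by omega)
    rw [show x - p + p = x by omega] at h1
    rw [show x - p + q = x + (q - p) by omega] at h2
    exact h1.symm.trans h2
  · have h1 := hp (x + (q - p)) (by omega) (by omega)
    have h2 := hq x (by omega) (by omega)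
    rw [show x + (q - p) + p = x + q by omega] at h1
    exact h2.trans h1.symm

/-- A weak form of the Fine–Wilf theorem. -/
theorem PeriodicIcc.gcd {lo hi p q : ℕ} (hp : PeriodicIcc S lo hi p) (hq : PeriodicIcc S lo hi q)
    (hlen : lo + p + q ≤ hi) : PeriodicIcc S lo hi (p.gcd q) := by
  induction hN : p + q using Nat.strong_induction_on generalizing p q with
  | _ N ih =>
    subst hN
    rcases Nat.eq_zero_or_pos p with rfl | hp0
    · simpa using hq
    rcases Nat.eq_zero_or_pos q with rfl | hq0
    · simpa using hp
    rcases le_total p q with h | h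
    · have := ih (p + (q - p)) (by omega) hp (hp.sub hq h hlen) (by omega) rfl
      rwa [Nat.gcd_sub_self_right h] at this
    · have := ih ((p - q) + q) (by omega) (hq.sub hp h (by omega)) hq (by omega) rfl
      rwa [Nat.gcd_sub_self_left h] at this

/-- Disjoint sets of sizes `a` and `b` in a domain of size `n` cannot be told apart by adding the
same further elements to both and asking whether the resulting size belongs to `S`. -/
def Interchangeable (S : Set ℕ) (n a b : ℕ) : Prop :=
  ∀ c, a + b + c ≤ n → (a + c ∈ S ↔ b + c ∈ S)

theorem Interchangeable.symm {n a b : ℕ} (h : Interchangeable S n a b) :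
    Interchangeable S n b a := fun c hc => (h c (by omega)).symm

theorem interchangeable_iff_eq {n a b : ℕ} (ha : a < fFun S n) (hb : b < fFun S n) :
    Interchangeable S n a b ↔ a = b := by
  constructor
  · intro h
    rcases lt_trichotomy a b with hab | hab | hab
    · obtain ⟨c, hc, hn⟩ := exists_not_iff_of_lt_fFun hab hb
      exact absurd (h c hc) hn
    · exact hab
    · obtain ⟨c, hc, hn⟩ := exists_not_iff_of_lt_fFun hab ha
      exact absurd (h.symm c hc) hn
  · rintro rfl c _
    rfl

/-- With `d = f - ω`, interchangeability of `d` and `r` says exactly that `r - d` is a period on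
`[d, n - d]`. By Fine–Wilf its gcd with `ω` is one too, and minimality of `ω` forces the gcd to be
`ω`. The hypothesis `r + f ≤ n` is the length required for Fine–Wilf. -/
theorem interchangeable_iff_dvd {n r : ℕ} (hr : fFun S n - omegaFun S n ≤ r)
    (hn : r + fFun S n ≤ n) :
    Interchangeable S n (fFun S n - omegaFun S n) r ↔
      omegaFun S n ∣ r - (fFun S n - omegaFun S n) := by
  have hle := omegaFun_le_fFun S n
  have hpos := omegaFun_pos S n
  have hper := periodicIcc_omegaFun S n
  have hmin := fun h => omegaFun_le (S := S) (n := n) (h := h)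
  have hd : fFun S n - omegaFun S n + omegaFun S n = fFun S n := by omega
  generalize fFun S n - omegaFun S n = d at *
  constructor
  · intro h
    have hp : PeriodicIcc S d (n - d) (r - d) := by
      intro x hx hx'
      have := h (x - d) (by omega)
      rwa [show d + (x - d) = x by omega, show r + (x - d) = x + (r - d) by omega] at this
    have hg := hp.gcd hper (by omega)
    have := hmin _ (Nat.gcd_pos_of_pos_right _ hpos) (Nat.gcd_le_right _ hpos) hg
    rw [← le_antisymm (Nat.gcd_le_right _ hpos) this]
    exact Nat.gcd_dvd_left _ _
  · rintro ⟨k, hk⟩ c hc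
    have := hper.mul k (d + c) (by omega) (by omega)
    rwa [← hk, show d + c + (r - d) = r + c by omega] at this

end Periodicity

/-! ### Pseudoloose sets satisfy the non-periodicity condition -/

section Pseudoloose

theorem add_le_of_le_gap {T : Set ℕ} {t m m' : ℕ} (h : (t : ℕ∞) ≤ gap T m) (hm' : m' ∈ T)
    (hlt : m < m') : m + t ≤ m' := by
  have h1 : gap T m ≤ ((m' - m : ℕ) : ℕ∞) := sInf_le ⟨m', hm', hlt, rfl⟩
  have h2 : t ≤ m' - m := by exact_mod_cast h.trans h1
  omega

/-- A `t`-separated set of integers in an interval of length `len` has at most `len / t + 1`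
elements. -/
theorem mul_card_le_of_separated {t a len : ℕ} (s : Finset ℕ)
    (hs : ∀ x ∈ s, a ≤ x ∧ x < a + len) (hsep : ∀ x ∈ s, ∀ y ∈ s, x < y → x + t ≤ y) :
    t * s.card ≤ len + t := by
  induction s using Finset.induction_on_max generalizing len with
  | empty => simp
  | insert m s hm ih =>
    have hmem := hs m (Finset.mem_insert_self _ _)
    rw [Finset.card_insert_of_notMem fun h => lt_irrefl _ (hm m h)]
    rcases s.eq_empty_or_nonempty with rfl | ⟨x, hx⟩
    · simp
    have hx' : ∀ x ∈ s, x + t ≤ m := fun x hx =>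
      hsep x (by simp [hx]) m (by simp) (hm x hx)
    have := hx' x hx
    have hax := (hs x (by simp [hx])).1
    rcases Nat.eq_zero_or_pos t with rfl | ht
    · simp
    have := ih (len := len - t) (fun y hy => ⟨(hs y (by simp [hy])).1, by have := hx' y hy; omega⟩)
      (fun y hy z hz => hsep y (by simp [hy]) z (by simp [hz]))
    rw [mul_add, mul_one]
    omega

theorem add_omegaFun_mem_occurrences {S : Set ℕ} {n s m : ℕ} {word : Fin s → Bool}
    (hm : m ∈ occurrences (charFun S) word) (hlo : fFun S n - omegaFun S n ≤ m)
    (hhi : m + s + fFun S n ≤ n) :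
    m + omegaFun S n ∈ occurrences (charFun S) word := by
  intro i
  have hle := omegaFun_le_fFun S n
  rw [← hm i]
  have := periodicIcc_omegaFun S n (m + i) (by omega) (by omega)
  rw [add_right_comm] at this
  exact decide_eq_decide.2 this.symm

/-- Either a long gap is forced to be at most the period, or all long gaps occur near the ends. -/
theorem le_omegaFun_or_mul_gapCount_le (S : Set ℕ) {n s t : ℕ} (word : Fin s → Bool) :
    t ≤ omegaFun S n ∨
      t * gapCount (occurrences (charFun S) word) n t ≤ 2 * fFun S n + s + 2 * t := by
  classical
  refine or_iff_not_imp_left.2 fun ht => ?_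
  set T := occurrences (charFun S) word with hT
  set G := {m : ℕ | m ∈ T ∧ (t : ℕ∞) ≤ gap T m ∧ m + t < n} with hG
  have hfin : G.Finite := (Set.finite_lt_nat n).subset fun m hm => by
    have := hm.2.2
    simp only [Set.mem_ofPred_eq]
    omega
  have hsep : ∀ x ∈ G, ∀ y ∈ G, x < y → x + t ≤ y := fun x hx y hy hxy =>
    add_le_of_le_gap hx.2.1 hy.1 hxy
  -- An occurrence in the middle recurs after `ω < t` places, contradicting a gap of at least `t`.
  have hmid : ∀ m ∈ G, m < fFun S n ∨ n < m + s + fFun S n := by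
    intro m hm
    by_contra! hcon
    have := add_le_of_le_gap hm.2.1 (add_omegaFun_mem_occurrences hm.1 (by omega) hcon.2)
      (by have := omegaFun_pos S n; omega)
    omega
  have hcard : gapCount T n t = hfin.toFinset.card := Set.ncard_eq_toFinset_card G hfin
  -- The two end pieces have lengths `f` and `s + f`; the separation bound costs an extra `t` for
  -- each.
  rw [hcard, ← Finset.card_filter_add_card_filter_not (fun m => m < fFun S n), mul_add]
  have h1 := mul_card_le_of_separated (t := t) (a := 0) (len := fFun S n)
    (hfin.toFinset.filter (fun m => m < fFun S n))
    (fun x hx => by simp only [Finset.mem_filter] at hx; omega)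
    (fun x hx y hy => hsep x (by simpa using (Finset.mem_filter.1 hx).1) y
      (by simpa using (Finset.mem_filter.1 hy).1))
  have h2 := mul_card_le_of_separated (t := t) (a := n - (s + fFun S n)) (len := s + fFun S n)
    (hfin.toFinset.filter (fun m => ¬ m < fFun S n))
    (fun x hx => by
      simp only [Finset.mem_filter, Set.Finite.mem_toFinset] at hx
      have := hmid x hx.1
      have := hx.1.2.2
      omega)
    (fun x hx y hy => hsep x (by simpa using (Finset.mem_filter.1 hx).1) y
      (by simpa using (Finset.mem_filter.1 hy).1))
  omega

theorem Pseudoloose.nonPeriodicityCondition {S : Set ℕ} (hS : Pseudoloose S) :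
    NonPeriodicityCondition S := by
  obtain ⟨ε, hε, hS⟩ := hS
  obtain ⟨k, hk⟩ := exists_nat_ge (4 / ε)
  obtain ⟨ℓ, hℓ⟩ := exists_nat_ge (1 / ε)
  refine ⟨k, ℓ, ?_⟩
  -- The `6` makes `s + 2 * t ≤ 3 * n ^ (1 - ε)` at most `ε * n / 2`, which leaves `ε * n ≤ 4 * f`;
  -- hence the choice `k ≥ 4 / ε`.
  have hlim : ∀ᶠ n : ℕ in atTop, (n : ℝ) ^ (-ε) < ε / 6 :=
    ((tendsto_rpow_neg_atTop hε).comp tendsto_natCast_atTop_atTop).eventually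
      (gt_mem_nhds (by positivity))
  filter_upwards [hS, hlim, eventually_ge_atTop 1] with n hn hsmall hn1
  obtain ⟨s, word, hs, t, ht0, hcount, htlo, hthi⟩ := hn
  have hn0 : (0 : ℝ) < n := by exact_mod_cast hn1
  have hω : (1 : ℝ) ≤ omegaFun S n := by exact_mod_cast omegaFun_pos S n
  have hf : (1 : ℝ) ≤ fFun S n := by exact_mod_cast fFun_pos S n
  have hkε : 4 ≤ k * ε := (div_le_iff₀ hε).1 hk
  have hk1 : (1 : ℝ) ≤ k := by
    have : 0 < k := Nat.pos_of_ne_zero (by rintro rfl; norm_num at hkε)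
    exact_mod_cast this
  suffices h : (n : ℝ) ≤ k * fFun S n * (omegaFun S n : ℝ) ^ ℓ by exact_mod_cast h
  rcases le_omegaFun_or_mul_gapCount_le S (n := n) (t := t) word with h | h
  · have h1 : (n : ℝ) ^ ε ≤ omegaFun S n := htlo.trans (by exact_mod_cast h)
    have hℓε : 1 ≤ ε * ℓ := by rw [mul_comm]; exact (div_le_iff₀ hε).1 hℓ
    calc (n : ℝ) = (n : ℝ) ^ (1 : ℝ) := (Real.rpow_one _).symm
      _ ≤ (n : ℝ) ^ (ε * ℓ) := Real.rpow_le_rpow_of_exponent_le (by exact_mod_cast hn1) hℓε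
      _ = ((n : ℝ) ^ ε) ^ ℓ := by rw [Real.rpow_mul hn0.le, Real.rpow_natCast]
      _ ≤ (omegaFun S n : ℝ) ^ ℓ := by gcongr
      _ ≤ k * fFun S n * (omegaFun S n : ℝ) ^ ℓ :=
        le_mul_of_one_le_left (by positivity) (one_le_mul_of_one_le_of_one_le hk1 hf)
  · have h' : (t : ℝ) * gapCount (occurrences (charFun S) word) n t ≤
        2 * fFun S n + s + 2 * t := by exact_mod_cast h
    have hpow : (n : ℝ) ^ (1 - ε) ≤ ε / 6 * n := by
      rw [sub_eq_add_neg, Real.rpow_add hn0, Real.rpow_one, mul_comm]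
      gcongr
    have h4 : ε * n ≤ 4 * fFun S n := by linarith
    have h5 : (n : ℝ) ≤ k * fFun S n := by
      have : 4 * (n : ℝ) ≤ k * ε * n := by gcongr
      have : (k : ℝ) * (ε * n) ≤ k * (4 * fFun S n) := by gcongr
      linarith
    exact h5.trans (le_mul_of_one_le_right (by positivity) (one_le_pow₀ hω))

end Pseudoloose

/-! ### Counting in finite linear orders -/

section Counting

variable {α : Type w}

/-- The number of elements satisfying `A`. -/
noncomputable def cnt (A : α → Prop) : ℕ := {x | A x}.ncard

theorem cnt_mono [Finite α] {A B : α → Prop} (h : ∀ x, A x → B x) : cnt A ≤ cnt B :=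
  Set.ncard_le_ncard (fun x hx => h x hx) (Set.toFinite _)

theorem cnt_congr {A B : α → Prop} (h : ∀ x, A x ↔ B x) : cnt A = cnt B := by
  rw [show A = B from funext fun x => propext (h x)]

theorem cnt_or [Finite α] {A B : α → Prop} (h : ∀ x, A x → ¬ B x) :
    cnt (fun x => A x ∨ B x) = cnt A + cnt B :=
  Set.ncard_union_eq (Set.disjoint_left.2 fun x hx hx' => h x hx hx') (Set.toFinite _)
    (Set.toFinite _)

theorem cnt_le_card [Finite α] (A : α → Prop) : cnt A ≤ Nat.card α := by
  rw [← Set.ncard_univ]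
  exact Set.ncard_le_ncard (Set.subset_univ _) (Set.toFinite _)

theorem cnt_true : cnt (fun _ : α => True) = Nat.card α := by
  rw [← Set.ncard_univ]
  rfl

theorem cnt_add_cnt_not [Finite α] (A : α → Prop) : cnt A + cnt (fun x => ¬ A x) = Nat.card α := by
  rw [← cnt_or fun x h => not_not.2 h, ← cnt_true]
  exact cnt_congr fun x => by tauto

/-- The relation `R` restricts to a one-to-one correspondence between `A` and `B`. -/
def IsMatching (A B : α → Prop) (R : α → α → Prop) : Prop :=
  (∀ x, A x → ∃ y, B y ∧ R x y) ∧ (∀ y, B y → ∃ x, A x ∧ R x y) ∧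
    (∀ x x' y, A x → A x' → B y → R x y → R x' y → x = x') ∧
    ∀ x y y', A x → B y → B y' → R x y → R x y' → y = y'

/-- Valid for arbitrary `R`, so a matching certifies equal size whatever the meaning of the formula
that describes it. -/
theorem IsMatching.cnt_eq {A B : α → Prop} {R : α → α → Prop} (h : IsMatching A B R) :
    cnt A = cnt B := by
  obtain ⟨h1, h2, h3, h4⟩ := h
  choose! φ hφ using h1
  refine Set.ncard_congr (fun x _ => φ x) (fun x hx => (hφ x hx).1) ?_ ?_
  · intro x y hx hy hxy
    exact h3 x y (φ x) hx hy (hφ x hx).1 (hφ x hx).2 (hxy ▸ (hφ y hy).2)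
  · intro y hy
    obtain ⟨x, hx, hxy⟩ := h2 y hy
    exact ⟨x, hx, h4 x _ _ hx (hφ x hx).1 hy (hφ x hx).2 hxy⟩

variable [LinearOrder α]

/-- The number of elements below `x` satisfying `A`. -/
noncomputable def rank (A : α → Prop) (x : α) : ℕ := cnt fun z => A z ∧ z < x

variable [Finite α] {A B : α → Prop}

theorem rank_lt_cnt {x : α} (hx : A x) : rank A x < cnt A :=
  Set.ncard_lt_ncard ⟨fun _ hz => hz.1, fun h => lt_irrefl x (h hx).2⟩ (Set.toFinite _)

theorem rank_mono {x y : α} (h : x ≤ y) : rank A x ≤ rank A y :=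
  cnt_mono fun _ hz => ⟨hz.1, hz.2.trans_le h⟩

theorem rank_lt_rank {x y : α} (hx : A x) (h : x < y) : rank A x < rank A y :=
  Set.ncard_lt_ncard ⟨fun _ hz => ⟨hz.1, lt_trans hz.2 h⟩, fun hs => lt_irrefl x (hs ⟨hx, h⟩).2⟩
    (Set.toFinite _)

theorem rank_lt_rank_iff {x y : α} (hx : A x) : rank A x < rank A y ↔ x < y :=
  ⟨fun h => lt_of_not_ge fun h' => absurd (rank_mono h') (not_le.2 h), rank_lt_rank hx⟩

theorem rank_le_rank_iff {x y : α} (hy : A y) : rank A x ≤ rank A y ↔ x ≤ y := by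
  rw [← not_lt, rank_lt_rank_iff hy, not_lt]

theorem rank_inj {x y : α} (hx : A x) (hy : A y) (h : rank A x = rank A y) : x = y :=
  le_antisymm ((rank_le_rank_iff hy).1 h.le) ((rank_le_rank_iff hx).1 h.ge)

theorem injOn_rank (A P : α → Prop) : Set.InjOn (rank A) {z | A z ∧ P z} :=
  fun _ hx _ hy h => rank_inj hx.1 hy.1 h

theorem exists_rank_eq {c : ℕ} (hc : c < cnt A) : ∃ x, A x ∧ rank A x = c := by
  have himg : rank A '' {x | A x} = (Finset.range (cnt A) : Set ℕ) := by
    refine Set.eq_of_subset_of_ncard_le ?_ ?_ (Finset.finite_toSet _)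
    · rintro _ ⟨x, hx, rfl⟩
      simpa using rank_lt_cnt (A := A) hx
    · have hinj : Set.InjOn (rank A) {x | A x} := fun x hx y hy h => rank_inj (A := A) hx hy h
      rw [hinj.ncard_image, Set.ncard_coe_finset, Finset.card_range]
      rfl
  have : c ∈ rank A '' {x | A x} := by
    rw [himg]
    simpa using hc
  obtain ⟨x, hx, rfl⟩ := this
  exact ⟨x, hx, rfl⟩

/-- Ranks identify `A` with `{0, …, cnt A - 1}`, so a subset of `A` can be counted through its set
of ranks. -/
theorem cnt_eq_card_of_rank {P : α → Prop} (s : Finset ℕ) (hP : ∀ z, P z → A z)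
    (hs : ∀ z, A z → (P z ↔ rank A z ∈ s)) (hlt : ∀ i ∈ s, i < cnt A) : cnt P = s.card := by
  have himg : rank A '' {z | A z ∧ P z} = s := by
    ext i
    constructor
    · rintro ⟨x, ⟨hx, hPx⟩, rfl⟩
      exact (hs x hx).1 hPx
    · intro hi
      obtain ⟨x, hx, rfl⟩ := exists_rank_eq (hlt i hi)
      exact ⟨x, ⟨hx, (hs x hx).2 hi⟩, rfl⟩
  rw [← Set.ncard_coe_finset, ← himg, (injOn_rank _ _).ncard_image]
  exact cnt_congr fun z => ⟨fun h => ⟨hP z h, h⟩, fun h => h.2⟩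

theorem isMatching_of_rank {R : α → α → Prop} (hAB : cnt A = cnt B)
    (hR : ∀ x y, A x → B y → (R x y ↔ rank A x = rank B y)) : IsMatching A B R := by
  refine ⟨fun x hx => ?_, fun y hy => ?_, fun x x' y hx hx' hy h h' => ?_,
    fun x y y' hx hy hy' h h' => ?_⟩
  · obtain ⟨y, hy, h⟩ := exists_rank_eq (hAB ▸ rank_lt_cnt hx)
    exact ⟨y, hy, (hR x y hx hy).2 h.symm⟩
  · obtain ⟨x, hx, h⟩ := exists_rank_eq (hAB ▸ rank_lt_cnt hy)
    exact ⟨x, hx, (hR x y hx hy).2 h⟩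
  · exact rank_inj hx hx' (((hR _ _ hx hy).1 h).trans ((hR _ _ hx' hy).1 h').symm)
  · exact rank_inj hy hy' (((hR _ _ hx hy).1 h).symm.trans ((hR _ _ hx hy').1 h'))

end Counting

/-! ### Comparing cardinalities by membership in `S` -/

section Comparison

variable {α : Type w} [LinearOrder α] {S : Set ℕ}

/-- `A` and `B` stay equivalent with respect to membership of the size in `S` when an initial
segment of the elements outside `A` and `B` is added to both. -/
def SwapInvariant (S : Set ℕ) (A B : α → Prop) : Prop :=
  (∀ y, cnt (fun z => A z ∨ (¬ A z ∧ ¬ B z) ∧ z < y) ∈ S ↔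
    cnt (fun z => B z ∨ (¬ A z ∧ ¬ B z) ∧ z < y) ∈ S) ∧
  (cnt (fun z => A z ∨ (¬ A z ∧ ¬ B z)) ∈ S ↔ cnt (fun z => B z ∨ (¬ A z ∧ ¬ B z)) ∈ S)

/-- The initial segments of the complement of `A ∪ B` realize every number `c` of added elements;
disjointness makes the bound on `c` equal to `n - a - b`. The whole complement need not be cut off
by an element `y`, hence the separate last clause of `SwapInvariant`. -/
theorem swapInvariant_iff [Finite α] {A B : α → Prop} (h : ∀ x, A x → ¬ B x) :
    SwapInvariant S A B ↔ Interchangeable S (Nat.card α) (cnt A) (cnt B) := by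
  have hout : cnt A + cnt B + cnt (fun z => ¬ A z ∧ ¬ B z) = Nat.card α := by
    rw [← cnt_or h, ← cnt_add_cnt_not fun z => A z ∨ B z]
    simp only [not_or]
  have hA : ∀ C : α → Prop, (∀ z, C z → ¬ A z ∧ ¬ B z) →
      cnt (fun z => A z ∨ C z) = cnt A + cnt C :=
    fun C hC => cnt_or fun z hz hz' => (hC z hz').1 hz
  have hB : ∀ C : α → Prop, (∀ z, C z → ¬ A z ∧ ¬ B z) →
      cnt (fun z => B z ∨ C z) = cnt B + cnt C :=
    fun C hC => cnt_or fun z hz hz' => (hC z hz').2 hz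
  unfold SwapInvariant
  rw [hA _ fun z hz => hz, hB _ fun z hz => hz]
  have key : ∀ y, (cnt (fun z => A z ∨ (¬ A z ∧ ¬ B z) ∧ z < y) ∈ S ↔
      cnt (fun z => B z ∨ (¬ A z ∧ ¬ B z) ∧ z < y) ∈ S) ↔
      (cnt A + rank (fun z => ¬ A z ∧ ¬ B z) y ∈ S ↔
        cnt B + rank (fun z => ¬ A z ∧ ¬ B z) y ∈ S) := by
    intro y
    rw [hA _ fun z hz => hz.1, hB _ fun z hz => hz.1]
    rfl
  simp only [key]
  constructor
  · rintro ⟨h1, h2⟩ c hc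
    rcases lt_or_eq_of_le (show c ≤ cnt (fun z => ¬ A z ∧ ¬ B z) by omega) with hlt | rfl
    · obtain ⟨y, -, rfl⟩ := exists_rank_eq hlt
      exact h1 y
    · exact h2
  · intro hI
    refine ⟨fun y => hI _ ?_, hI _ hout.le⟩
    have : rank (fun z => ¬ A z ∧ ¬ B z) y ≤ cnt (fun z => ¬ A z ∧ ¬ B z) :=
      cnt_mono fun _ hz => hz.1
    omega

/-- A relation between unary predicates on linear orders. -/
abbrev SetRel : Type (w + 1) :=
  ∀ (α : Type w) [LinearOrder α], (α → Prop) → (α → Prop) → Prop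

/-- `F` relates only predicates of equal size. -/
def SetRel.Sound (F : SetRel.{w}) : Prop :=
  ∀ (α : Type w) [LinearOrder α] [Finite α] (A B : α → Prop), F α A B → cnt A = cnt B

/-- On `α`, `F` relates all predicates of equal size at most `g`. -/
def SetRel.CompleteUpTo (F : SetRel.{w}) (α : Type w) [LinearOrder α] (g : ℕ) : Prop :=
  ∀ A B : α → Prop, cnt A = cnt B → cnt A ≤ g → F α A B

theorem SetRel.CompleteUpTo.iff {F : SetRel.{w}} {g : ℕ} [Finite α] (hF : F.CompleteUpTo α g)
    (hs : F.Sound) {A B : α → Prop} (hA : cnt A ≤ g) : F α A B ↔ cnt A = cnt B :=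
  ⟨hs α A B, fun h => hF A B h hA⟩

/-- Matching elements of equal rank, where ranks are compared by `SwapInvariant`. -/
def swapRel (S : Set ℕ) : SetRel.{w} := fun _ _ A B =>
  IsMatching A B fun x y =>
    SwapInvariant S (fun z => (A z ∧ z < x) ∧ ¬ (B z ∧ z < y))
      (fun z => (B z ∧ z < y) ∧ ¬ (A z ∧ z < x))

theorem swapRel_sound (S : Set ℕ) : (swapRel.{w} S).Sound := fun _ _ _ _ _ h => h.cnt_eq

/-- Removing the common part of the two initial segments makes them disjoint without changing the
difference of their sizes. What remains has size below `fFun S (Nat.card α)`, where interchangeable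
means equal. -/
theorem swapRel_completeUpTo [Finite α] (S : Set ℕ) :
    (swapRel S).CompleteUpTo α (fFun S (Nat.card α)) := by
  intro A B hAB hA
  refine isMatching_of_rank hAB fun x y hx hy => ?_
  rw [swapInvariant_iff fun z hz hz' => hz.2 hz'.1]
  have h1 : rank A x = cnt (fun z => (A z ∧ z < x) ∧ (B z ∧ z < y)) +
      cnt (fun z => (A z ∧ z < x) ∧ ¬ (B z ∧ z < y)) := by
    rw [← cnt_or fun z hz hz' => hz'.2 hz.2]
    exact cnt_congr fun z => by tauto
  have h2 : rank B y = cnt (fun z => (A z ∧ z < x) ∧ (B z ∧ z < y)) +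
      cnt (fun z => (B z ∧ z < y) ∧ ¬ (A z ∧ z < x)) := by
    rw [← cnt_or fun z hz hz' => hz'.2 hz.1]
    exact cnt_congr fun z => by tauto
  have h3 := rank_lt_cnt hx
  have h4 := rank_lt_cnt hy
  rw [interchangeable_iff_eq (by omega) (by omega)]
  omega

/-- The elements `m ≥ x₀` of `A` such that the elements of `A` below `m` are interchangeable with
the elements outside `A` below `u`. -/
def Mark (S : Set ℕ) (A : α → Prop) (x₀ u m : α) : Prop :=
  A m ∧ x₀ ≤ m ∧ SwapInvariant S (fun z => ¬ A z ∧ z < u) (fun z => A z ∧ z < m)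

/-- The elements of `A` below `x` that are not below any mark `m ≤ x`. -/
def AfterMark (S : Set ℕ) (A : α → Prop) (x₀ u x z : α) : Prop :=
  A z ∧ z < x ∧ ∀ m, Mark S A x₀ u m → m ≤ x → m ≤ z

/-- Matching elements whose ranks agree as to the number of marks up to them and the distance from
the last mark, both compared by `F`. -/
def blockRel (S : Set ℕ) (F : SetRel.{w}) : SetRel.{w} := fun α _ A B =>
  -- Intended parameters: `x₀`, `y₀` of rank `d = f - ω` in `A`, `B`, and `u`, `v` of rank `d` in
  -- their complements. The first disjunct covers sets too small to have an element of rank `d`.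
  F α A B ∨ ∃ x₀ u y₀ v, IsMatching A B fun x y =>
    F α (fun m => Mark S A x₀ u m ∧ m ≤ x) (fun m => Mark S B y₀ v m ∧ m ≤ y) ∧
      F α (AfterMark S A x₀ u x) (AfterMark S B y₀ v y)

theorem blockRel_sound {F : SetRel.{w}} (hF : F.Sound) : (blockRel S F).Sound := by
  rintro α _ _ A B (h | ⟨x₀, u, y₀, v, h⟩)
  · exact hF α A B h
  · exact h.cnt_eq

/-! ### Marks and remainders computed from ranks -/

section Marks

variable [Finite α] {A : α → Prop} {x₀ u : α}

/-- The `d` elements outside `A` below `u` serve as a reference set of size `d` disjoint from `A`.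
Keeping `cnt A` and `f` within half of the domain provides `rank A m + f ≤ n`, needed for the
divisibility criterion. -/
theorem mark_iff {d : ℕ} (hd : fFun S (Nat.card α) - omegaFun S (Nat.card α) = d)
    (hA : 2 * cnt A ≤ Nat.card α) (hf : 2 * fFun S (Nat.card α) ≤ Nat.card α)
    (hrx : rank A x₀ = d) (hru : rank (fun z => ¬ A z) u = d) (m : α) (hm : A m) :
    Mark S A x₀ u m ↔ d ≤ rank A m ∧ omegaFun S (Nat.card α) ∣ rank A m - d := by
  unfold Mark
  rw [swapInvariant_iff fun z hz hz' => hz.1 hz'.1]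
  have h1 : cnt (fun z => ¬ A z ∧ z < u) = d := hru
  have h2 : cnt (fun z => A z ∧ z < m) = rank A m := rfl
  have h3 := rank_lt_cnt hm
  rw [h1, h2, ← rank_le_rank_iff hm, hrx]
  subst hd
  simp only [hm, true_and]
  exact and_congr_right fun hle => interchangeable_iff_dvd hle (by omega)

/-- The marks up to `x` have the ranks `d + q * k` not exceeding that of `x`; the `+ 1` accounts for
the mark at `d` itself. -/
theorem cnt_mark_and_le {d q : ℕ} (hq : 0 < q)
    (hmark : ∀ m, A m → (Mark S A x₀ u m ↔ d ≤ rank A m ∧ q ∣ rank A m - d)) {x : α} (hx : A x) :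
    cnt (fun m => Mark S A x₀ u m ∧ m ≤ x) =
      if rank A x < d then 0 else (rank A x - d) / q + 1 := by
  have hrx := rank_lt_cnt hx
  split_ifs with hlt
  · refine cnt_eq_card_of_rank (A := A) ∅ (fun z hz => hz.1.1) (fun z hz => ?_) (by simp)
    rw [hmark z hz, ← rank_le_rank_iff hx]
    simp only [Finset.notMem_empty, iff_false]
    omega
  have hinj : Function.Injective fun k => d + q * k := fun a b h =>
    Nat.eq_of_mul_eq_mul_left hq (Nat.add_left_cancel h)
  have hle : ∀ k, k < (rank A x - d) / q + 1 ↔ q * k ≤ rank A x - d := fun k => by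
    rw [Nat.lt_succ_iff, Nat.le_div_iff_mul_le hq, mul_comm]
  rw [← Finset.card_range ((rank A x - d) / q + 1), ← Finset.card_image_of_injective _ hinj]
  refine cnt_eq_card_of_rank (A := A) _ (fun z hz => hz.1.1) (fun z hz => ?_) ?_
  · rw [hmark z hz, ← rank_le_rank_iff hx]
    simp only [Finset.mem_image, Finset.mem_range, hle]
    constructor
    · rintro ⟨⟨hd, k, hk⟩, hz⟩
      exact ⟨k, by omega, by omega⟩
    · rintro ⟨k, hk, hkz⟩
      exact ⟨⟨by omega, k, by omega⟩, by omega⟩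
  · simp only [Finset.mem_image, Finset.mem_range, hle]
    rintro _ ⟨k, hk, rfl⟩
    omega

/-- The last mark up to `x` has rank `d + q * ((rank A x - d) / q)`, and what lies from it up to `x`
is the remainder. Below rank `d` there is no mark, so all elements below `x` count. -/
theorem cnt_afterMark {d q : ℕ} (hq : 0 < q)
    (hmark : ∀ m, A m → (Mark S A x₀ u m ↔ d ≤ rank A m ∧ q ∣ rank A m - d)) {x : α} (hx : A x) :
    cnt (AfterMark S A x₀ u x) =
      if rank A x < d then rank A x else (rank A x - d) % q := by
  have hrx := rank_lt_cnt hx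
  have hiff : ∀ z, A z → (AfterMark S A x₀ u x z ↔ rank A z < rank A x ∧
      ∀ j < cnt A, d ≤ j ∧ q ∣ j - d → j ≤ rank A x → j ≤ rank A z) := by
    intro z hz
    unfold AfterMark
    rw [rank_lt_rank_iff hz]
    simp only [hz, true_and]
    refine and_congr_right fun _ => ⟨fun h j hj hjd hjx => ?_, fun h m hm hmx => ?_⟩
    · obtain ⟨m, hm, rfl⟩ := exists_rank_eq hj
      exact rank_mono (h m ((hmark m hm).2 hjd) ((rank_le_rank_iff hx).1 hjx))
    · exact (rank_le_rank_iff hz).1 (h _ (rank_lt_cnt hm.1) ((hmark m hm.1).1 hm) (rank_mono hmx))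
  split_ifs with hlt
  · rw [← Finset.card_range (rank A x)]
    refine cnt_eq_card_of_rank (A := A) _ (fun z hz => hz.1) (fun z hz => ?_) fun i hi => ?_
    · rw [hiff z hz, Finset.mem_range]
      refine ⟨fun h => h.1, fun h => ⟨h, fun j _ hj hjx => ?_⟩⟩
      omega
    · rw [Finset.mem_range] at hi
      omega
  have hdiv := Nat.div_add_mod (rank A x - d) q
  have hmod := Nat.mod_lt (rank A x - d) hq
  have hcard : (rank A x - d) % q =
      (Finset.Ico (d + q * ((rank A x - d) / q)) (rank A x)).card := by
    rw [Nat.card_Ico]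
    omega
  rw [hcard]
  refine cnt_eq_card_of_rank (A := A) _ (fun z hz => hz.1) (fun z hz => ?_) fun i hi => ?_
  · rw [hiff z hz, Finset.mem_Ico]
    constructor
    · rintro ⟨hzx, h⟩
      exact ⟨h _ (by omega) ⟨by omega, (rank A x - d) / q, by omega⟩ (by omega), hzx⟩
    · rintro ⟨hi, hir⟩
      refine ⟨hir, ?_⟩
      rintro j - ⟨hj, k, hk⟩ hjr
      have : k ≤ (rank A x - d) / q := (Nat.le_div_iff_mul_le hq).2 (by rw [mul_comm]; omega)
      have := Nat.mul_le_mul_left q this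
      omega
  · rw [Finset.mem_Ico] at hi
    omega

end Marks

/-- Quotient and remainder of `rank - d` by `ω` determine the rank. Both counts compared by `F` are
at most `g`: the quotient is below `g` since `cnt A ≤ g * ω`, and the remainder is below `ω ≤ f ≤
g`, or else the rank is below `d ≤ g`. -/
theorem blockRel_completeUpTo [Finite α] {F : SetRel.{w}} (hF : F.Sound) {g : ℕ}
    (hf : 2 * fFun S (Nat.card α) ≤ Nat.card α) (hg : fFun S (Nat.card α) ≤ g)
    (hFg : F.CompleteUpTo α g) :
    (blockRel S F).CompleteUpTo α (min (g * omegaFun S (Nat.card α)) (Nat.card α / 2)) := by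
  intro A B hAB hA
  -- In the other case `cnt A > g ≥ f > d`, so an element of rank `d` exists.
  by_cases hAg : cnt A ≤ g
  · exact Or.inl (hFg A B hAB hAg)
  have hA1 : cnt A ≤ g * omegaFun S (Nat.card α) := hA.trans (min_le_left _ _)
  have hA2 : 2 * cnt A ≤ Nat.card α := by
    have := hA.trans (min_le_right _ _)
    omega
  have hB2 : 2 * cnt B ≤ Nat.card α := by omega
  have hω := omegaFun_pos S (Nat.card α)
  have hωf := omegaFun_le_fFun S (Nat.card α)
  have hAn := cnt_add_cnt_not A
  have hBn := cnt_add_cnt_not B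
  obtain ⟨x₀, -, hrx⟩ := exists_rank_eq
    (show fFun S (Nat.card α) - omegaFun S (Nat.card α) < cnt A by omega)
  obtain ⟨u, -, hru⟩ := exists_rank_eq
    (show fFun S (Nat.card α) - omegaFun S (Nat.card α) < cnt (fun z => ¬ A z) by omega)
  obtain ⟨y₀, -, hry⟩ := exists_rank_eq
    (show fFun S (Nat.card α) - omegaFun S (Nat.card α) < cnt B by omega)
  obtain ⟨v, -, hrv⟩ := exists_rank_eq
    (show fFun S (Nat.card α) - omegaFun S (Nat.card α) < cnt (fun z => ¬ B z) by omega)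
  refine Or.inr ⟨x₀, u, y₀, v, isMatching_of_rank hAB fun x y hx hy => ?_⟩
  have c1 := cnt_mark_and_le hω (mark_iff rfl hA2 hf hrx hru) hx
  have c2 := cnt_mark_and_le hω (mark_iff rfl hB2 hf hry hrv) hy
  have c3 := cnt_afterMark hω (mark_iff rfl hA2 hf hrx hru) hx
  have c4 := cnt_afterMark hω (mark_iff rfl hB2 hf hry hrv) hy
  have hrA := rank_lt_cnt hx
  generalize hd : fFun S (Nat.card α) - omegaFun S (Nat.card α) = d at *
  generalize omegaFun S (Nat.card α) = ω at *
  have hmod := fun r => Nat.mod_lt (r - d) hω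
  have hdiv := fun r => Nat.div_add_mod (r - d) ω
  have hq : (rank A x - d) / ω < g := by
    rw [Nat.div_lt_iff_lt_mul hω]
    omega
  rw [hFg.iff hF, hFg.iff hF, c1, c2, c3, c4]
  · have hA' := hdiv (rank A x)
    have hB' := hdiv (rank B y)
    constructor
    · rintro ⟨h1, h2⟩
      -- The number of marks is `0` exactly for ranks below `d`, so equal numbers exclude the mixed
      -- cases.
      split_ifs at h1 h2
      · exact h2
      · have h3 : (rank A x - d) / ω = (rank B y - d) / ω := by omega
        rw [h3] at hA'
        omega
    · rintro h
      rw [h]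
      exact ⟨rfl, rfl⟩
  · rw [c3]
    have := hmod (rank A x)
    split_ifs <;> omega
  · rw [c1]
    split_ifs <;> omega

/-- Cutting both predicates into an initial and a final part and comparing the parts by `F`. -/
def splitRel (F : SetRel.{w}) : SetRel.{w} := fun α _ A B =>
  ∃ x y, F α (fun z => A z ∧ z < x) (fun z => B z ∧ z < y) ∧
    F α (fun z => A z ∧ ¬ z < x) (fun z => B z ∧ ¬ z < y)

theorem cnt_eq_rank_add [Finite α] (A : α → Prop) (x : α) :
    cnt A = rank A x + cnt (fun z => A z ∧ ¬ z < x) := by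
  unfold rank
  rw [← cnt_or fun z hz hz' => hz'.2 hz.2]
  exact cnt_congr fun z => by tauto

theorem splitRel_sound {F : SetRel.{w}} (hF : F.Sound) : (splitRel F).Sound := by
  rintro α _ _ A B ⟨x, y, h1, h2⟩
  rw [cnt_eq_rank_add A x, cnt_eq_rank_add B y]
  exact congrArg₂ (· + ·) (hF _ _ _ h1) (hF _ _ _ h2)

theorem splitRel_completeUpTo [Finite α] [Nonempty α] {F : SetRel.{w}} {g : ℕ}
    (hF : F.CompleteUpTo α g) : (splitRel F).CompleteUpTo α (g * 2) := by
  intro A B hAB hA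
  obtain ⟨x, y, hx, hy⟩ : ∃ x y, rank A x = cnt A / 2 ∧ rank B y = cnt A / 2 := by
    -- Empty sets have no element of their own to cut at; any element of the nonempty domain serves.
    rcases Nat.eq_zero_or_pos (cnt A) with h0 | h0
    · obtain ⟨x⟩ := ‹Nonempty α›
      have h1 := cnt_eq_rank_add A x
      have h2 := cnt_eq_rank_add B x
      exact ⟨x, x, by omega, by omega⟩
    · obtain ⟨x, -, hx⟩ := exists_rank_eq (show cnt A / 2 < cnt A by omega)
      obtain ⟨y, -, hy⟩ := exists_rank_eq (show cnt A / 2 < cnt B by omega)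
      exact ⟨x, y, hx, hy⟩
  have h1 := cnt_eq_rank_add A x
  have h2 := cnt_eq_rank_add B y
  refine ⟨x, y, hF _ _ (hx.trans hy.symm) ?_, hF _ _ ?_ ?_⟩
  · change rank A x ≤ g
    omega
  · omega
  · omega

/-- Under the non-periodicity condition, finitely many block and split steps turn `swapRel` into
equicardinality on all finite nonempty linear orders. -/
theorem exists_iterate_iff_cnt_eq (hS : NonPeriodicityCondition S) :
    ∃ r ℓ : ℕ, ∀ (α : Type w) [LinearOrder α] [Finite α] [Nonempty α] (A B : α → Prop),
      (splitRel^[r] ((blockRel S)^[ℓ] (swapRel.{w} S))) α A B ↔ cnt A = cnt B := by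
  obtain ⟨k, ℓ, hk⟩ := hS
  obtain ⟨n₀, hn₀⟩ := eventually_atTop.1 hk
  -- The factor `2 ^ (n₀ + k + 2)` exceeds `n₀`, settling domains below the threshold, exceeds `k`,
  -- and is at least `4`, which recovers `N` from the rounded bound `N / 2` when `N ≥ 2`.
  refine ⟨n₀ + k + 2, ℓ, ?_⟩
  intro α _ _ _ A B
  have hsb : ∀ j, ((blockRel S)^[j] (swapRel.{w} S)).Sound := by
    intro j
    induction j with
    | zero => exact swapRel_sound S
    | succ j ih => rw [Function.iterate_succ_apply']; exact blockRel_sound ih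
  have hss : ∀ r, (splitRel^[r] ((blockRel S)^[ℓ] (swapRel.{w} S))).Sound := by
    intro r
    induction r with
    | zero => exact hsb ℓ
    | succ r ih => rw [Function.iterate_succ_apply']; exact splitRel_sound ih
  have hcs : ∀ g r, ((blockRel S)^[ℓ] (swapRel.{w} S)).CompleteUpTo α g →
      (splitRel^[r] ((blockRel S)^[ℓ] (swapRel.{w} S))).CompleteUpTo α (g * 2 ^ r) := by
    intro g r hg
    induction r with
    | zero => simpa using hg
    | succ r ih =>
      rw [Function.iterate_succ_apply', pow_succ, ← mul_assoc]
      exact splitRel_completeUpTo ih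
  set N := Nat.card α with hN
  have hf0 := fFun_pos S N
  have hbase : ∀ j, ((blockRel S)^[j] (swapRel.{w} S)).CompleteUpTo α (fFun S N) := by
    intro j
    induction j with
    | zero => exact swapRel_completeUpTo S
    | succ j ih =>
      rw [Function.iterate_succ_apply']
      exact fun A B h h' => Or.inl (ih A B h h')
  obtain ⟨g, hg, hgN⟩ : ∃ g, ((blockRel S)^[ℓ] (swapRel.{w} S)).CompleteUpTo α g ∧
      N ≤ g * 2 ^ (n₀ + k + 2) := by
    have hpow : n₀ + k + 2 < 2 ^ (n₀ + k + 2) := Nat.lt_two_pow_self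
    by_cases hNn : N < n₀
    · refine ⟨_, hbase ℓ, ?_⟩
      nlinarith
    -- If this fails, `f` is already more than half of the domain and doubling alone suffices.
    by_cases hf : 2 * fFun S N ≤ N
    · have hblock : ∀ j, ((blockRel S)^[j] (swapRel.{w} S)).CompleteUpTo α
          (min (fFun S N * omegaFun S N ^ j) (N / 2)) := by
        intro j
        induction j with
        | zero => exact fun A B h h' => hbase 0 A B h (h'.trans (by simp))
        | succ j ih =>
          rw [Function.iterate_succ_apply']
          have hω := omegaFun_pos S N
          have := blockRel_completeUpTo (hsb j) hf
            (le_min (Nat.le_mul_of_pos_right _ (pow_pos hω j)) (by rw [← hN]; omega)) ih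
          refine fun A B h h' => this A B h (h'.trans (le_min ?_ (min_le_right _ _)))
          rcases min_cases (fFun S N * omegaFun S N ^ j) (N / 2) with ⟨h1, -⟩ | ⟨h1, -⟩
          · rw [h1, mul_assoc, ← pow_succ]
            exact min_le_left _ _
          · rw [h1]
            exact (min_le_right _ _).trans (Nat.le_mul_of_pos_right _ hω)
      refine ⟨_, hblock ℓ, ?_⟩
      rcases min_cases (fFun S N * omegaFun S N ^ ℓ) (N / 2) with ⟨h1, -⟩ | ⟨h1, -⟩
      · rw [h1]
        calc N ≤ k * fFun S N * omegaFun S N ^ ℓ := hn₀ N (not_lt.1 hNn)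
          _ = fFun S N * omegaFun S N ^ ℓ * k := by ring
          _ ≤ _ := Nat.mul_le_mul_left _ (by omega)
      · rw [h1]
        have h4 : 4 ≤ 2 ^ (n₀ + k + 2) := by
          calc 4 = 2 ^ 2 := rfl
            _ ≤ _ := Nat.pow_le_pow_right (by norm_num) (by omega)
        have := Nat.mul_le_mul_left (N / 2) h4
        omega
    · refine ⟨_, hbase ℓ, ?_⟩
      have := Nat.mul_le_mul_left (fFun S N) (show 2 ≤ 2 ^ (n₀ + k + 2) by omega)
      omega
  exact (hcs g _ hg).iff (hss _) ((cnt_le_card A).trans hgN)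

end Comparison

/-! ### Definability of equicardinality -/

section DefinableRelations

variable {S : Set ℕ} {L : FirstOrder.Language.{u, v}} {n : ℕ}
  {A B : ∀ M : BrModel.{u, v, w} L, (Fin n → M.carrier) → M.carrier → Prop}

theorem Dfn.cnt_mem (h : DfnSet (cardinalityQuantifier.{w} S) A) :
    Dfn (cardinalityQuantifier.{w} S) fun M e => cnt (A M e) ∈ S :=
  Dfn.ncard_mem h

theorem Dfn.swapInvariant (hA : DfnSet (cardinalityQuantifier.{w} S) A)
    (hB : DfnSet (cardinalityQuantifier.{w} S) B) :
    Dfn (cardinalityQuantifier.{w} S) fun M e => SwapInvariant S (A M e) (B M e) := by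
  unfold SwapInvariant
  refine .and (.all (.iff (.cnt_mem ?_) (.cnt_mem ?_))) (.iff (.cnt_mem ?_) (.cnt_mem ?_))
  · exact .or (.subst hA _ _)
      (.and (.and (.not (.subst hA _ _)) (.not (.subst hB _ _))) (.lt _ _))
  · exact .or (.subst hB _ _)
      (.and (.and (.not (.subst hA _ _)) (.not (.subst hB _ _))) (.lt _ _))
  · exact .or (.subst hA _ _) (.and (.not (.subst hA _ _)) (.not (.subst hB _ _)))
  · exact .or (.subst hB _ _) (.and (.not (.subst hA _ _)) (.not (.subst hB _ _)))

theorem Dfn.mark (hA : DfnSet (cardinalityQuantifier.{w} S) A) {m : ℕ} (σ : Fin n → Fin m)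
    (i j k : Fin m) :
    Dfn (cardinalityQuantifier.{w} S) fun (M : BrModel.{u, v, w} L) (e : Fin m → M.carrier) =>
      Mark S (A M fun i => e (σ i)) (e i) (e j) (e k) := by
  unfold Mark
  exact .and (.subst hA _ _) (.and (.le _ _)
    (.swapInvariant (.and (.not (.subst hA _ _)) (.lt _ _)) (.and (.subst hA _ _) (.lt _ _))))

theorem Dfn.afterMark (hA : DfnSet (cardinalityQuantifier.{w} S) A) {m : ℕ} (σ : Fin n → Fin m)
    (i j k l : Fin m) :
    Dfn (cardinalityQuantifier.{w} S) fun (M : BrModel.{u, v, w} L) (e : Fin m → M.carrier) =>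
      AfterMark S (A M fun i => e (σ i)) (e i) (e j) (e k) (e l) := by
  unfold AfterMark
  exact .and (.subst hA _ _) (.and (.lt _ _) (.all (.imp (.mark hA _ _ _ _)
    (.imp (.le _ _) (.le _ _)))))

/-- A binary relation with parameters is treated as a set whose last parameter is the first
argument. -/
theorem Dfn.subst₂ {Q : BrQuantifier.{w}}
    {R : ∀ M : BrModel.{u, v, w} L, (Fin n → M.carrier) → M.carrier → M.carrier → Prop}
    (hR : DfnSet Q (n := n + 1) fun M e => R M (fun i => e i.castSucc) (e (Fin.last n)))
    {m : ℕ} (σ : Fin n → Fin m) (i j : Fin m) :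
    Dfn Q fun (M : BrModel.{u, v, w} L) (e : Fin m → M.carrier) =>
      R M (fun i => e (σ i)) (e i) (e j) := by
  have := Dfn.subst hR (Fin.snoc σ i : Fin (n + 1) → Fin m) j
  simpa only [Fin.snoc_castSucc, Fin.snoc_last] using this

theorem Dfn.isMatching {Q : BrQuantifier.{w}}
    {R : ∀ M : BrModel.{u, v, w} L, (Fin n → M.carrier) → M.carrier → M.carrier → Prop}
    (hA : DfnSet Q A) (hB : DfnSet Q B)
    (hR : DfnSet Q (n := n + 1) fun M e => R M (fun i => e i.castSucc) (e (Fin.last n))) :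
    Dfn Q fun M e => IsMatching (A M e) (B M e) (R M e) := by
  unfold IsMatching
  refine .and (.all (.imp (.subst hA _ _) (.ex (.and (.subst hB _ _) (.subst₂ hR _ _ _)))))
    (.and (.all (.imp (.subst hB _ _) (.ex (.and (.subst hA _ _) (.subst₂ hR _ _ _)))))
    (.and (.all (.all (.all (.imp (.subst hA _ _) (.imp (.subst hA _ _) (.imp (.subst hB _ _)
      (.imp (.subst₂ hR _ _ _) (.imp (.subst₂ hR _ _ _) (.equal _ _)))))))))
    (.all (.all (.all (.imp (.subst hA _ _) (.imp (.subst hB _ _) (.imp (.subst hB _ _)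
      (.imp (.subst₂ hR _ _ _) (.imp (.subst₂ hR _ _ _) (.equal _ _)))))))))))

/-- `F` preserves definability in `FO_≤(C_S)`. -/
def SetRel.Definable (S : Set ℕ) (F : SetRel.{w}) : Prop :=
  ∀ (L : FirstOrder.Language.{u, v}) (n : ℕ)
    (A B : ∀ M : BrModel.{u, v, w} L, (Fin n → M.carrier) → M.carrier → Prop),
    DfnSet (cardinalityQuantifier.{w} S) A → DfnSet (cardinalityQuantifier.{w} S) B →
      Dfn (cardinalityQuantifier.{w} S) fun M e => F M.carrier (A M e) (B M e)

theorem swapRel_definable (S : Set ℕ) : SetRel.Definable.{u, v, w} S (swapRel S) := by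
  intro L n A B hA hB
  unfold swapRel
  exact .isMatching hA hB (.swapInvariant
    (.and (.and (.subst hA _ _) (.lt _ _)) (.not (.and (.subst hB _ _) (.lt _ _))))
    (.and (.and (.subst hB _ _) (.lt _ _)) (.not (.and (.subst hA _ _) (.lt _ _)))))

theorem blockRel_definable {F : SetRel.{w}} (hF : SetRel.Definable.{u, v, w} S F) :
    SetRel.Definable.{u, v, w} S (blockRel S F) := by
  intro L n A B hA hB
  unfold blockRel
  exact .or (hF _ _ _ _ hA hB) (.ex (.ex (.ex (.ex (.isMatching (.subst hA _ _) (.subst hB _ _)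
    (.and (hF _ _ _ _ (.and (.mark hA _ _ _ _) (.le _ _)) (.and (.mark hB _ _ _ _) (.le _ _)))
      (hF _ _ _ _ (.afterMark hA _ _ _ _ _) (.afterMark hB _ _ _ _ _))))))))

theorem splitRel_definable {F : SetRel.{w}} (hF : SetRel.Definable.{u, v, w} S F) :
    SetRel.Definable.{u, v, w} S (splitRel F) := by
  intro L n A B hA hB
  unfold splitRel
  exact .ex (.ex (.and
    (hF _ _ _ _ (.and (.subst hA _ _) (.lt _ _)) (.and (.subst hB _ _) (.lt _ _)))
    (hF _ _ _ _ (.and (.subst hA _ _) (.not (.lt _ _))) (.and (.subst hB _ _) (.not (.lt _ _))))))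

/-- Under the non-periodicity condition, equicardinality of definable predicates is definable in
`FO_≤(C_S)`. -/
theorem NonPeriodicityCondition.dfn_cnt_eq (hS : NonPeriodicityCondition S)
    (hA : DfnSet (cardinalityQuantifier.{w} S) A) (hB : DfnSet (cardinalityQuantifier.{w} S) B) :
    Dfn (cardinalityQuantifier.{w} S) fun M e => cnt (A M e) = cnt (B M e) := by
  obtain ⟨r, ℓ, h⟩ := exists_iterate_iff_cnt_eq.{w} hS
  have hdef : SetRel.Definable.{u, v, w} S (splitRel^[r] ((blockRel S)^[ℓ] (swapRel.{w} S))) := by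
    refine Function.Iterate.rec (SetRel.Definable.{u, v, w} S) ?_ (fun _ => splitRel_definable) r
    exact Function.Iterate.rec (SetRel.Definable.{u, v, w} S) (swapRel_definable S)
      (fun _ => blockRel_definable) ℓ
  exact (hdef L n A B hA hB).congr fun M e => (h M.carrier _ _).symm

/-! ### Translating formulas with the Härtig quantifier -/

/-- Induction on the formula handles nested quantifiers: the subformulas under a Härtig quantifier
already define sets in `FO_≤(C_S)`, and equicardinality of such sets is definable with parameters.
-/
theorem NonPeriodicityCondition.dfn_realize (hS : NonPeriodicityCondition S)
    (φ : Formula hartigQuantifier.{w} L n) :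
    Dfn (cardinalityQuantifier.{w} S) fun (M : BrModel.{u, v, w} L) e => φ.Realize M e := by
  induction φ with
  | falsum => exact ⟨.falsum, fun _ _ => Iff.rfl⟩
  | equal t₁ t₂ => exact ⟨.equal t₁ t₂, fun _ _ => Iff.rfl⟩
  | le t₁ t₂ => exact ⟨.le t₁ t₂, fun _ _ => Iff.rfl⟩
  | rel R ts => exact ⟨.rel R ts, fun _ _ => Iff.rfl⟩
  | imp φ ψ ihφ ihψ => exact ihφ.imp ihψ
  | all φ ih =>
    obtain ⟨φ', h⟩ := ih
    exact ⟨.all φ', fun M e => forall_congr' fun a => h M _⟩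
  | quant ψ ih =>
    have hset : ∀ R, DfnSet (cardinalityQuantifier.{w} S)
        fun (M : BrModel.{u, v, w} L) e a => (ψ 1 R).Realize M (Fin.snoc e a) := fun R =>
      (ih 1 R).congr fun M e => by
        beta_reduce
        rw [show (Fin.snoc (fun i => e i.castSucc) (e (Fin.last _)) : Fin _ → M.carrier) = e from
          Fin.snoc_init_self e]
    exact (hS.dfn_cnt_eq (hset HartigRel.U) (hset HartigRel.V)).congr fun M e =>
      realize_hartigQuantifier M ψ e

theorem NonPeriodicityCondition.atMostAsStrong (hS : NonPeriodicityCondition S) :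
    AtMostAsStrong.{u, v, w} hartigQuantifier.{w} (cardinalityQuantifier.{w} S) := by
  rintro L C ⟨φ, hφ⟩
  obtain ⟨φ', hφ'⟩ := hS.dfn_realize φ
  exact ⟨φ', fun M => (hφ M).trans (hφ' M _)⟩

theorem NonPeriodicityCondition.quantifierDefinableIn (hS : NonPeriodicityCondition S) :
    QuantifierDefinableIn hartigQuantifier.{w} (cardinalityQuantifier.{w} S) := by
  have hset : ∀ R : hartigVocab.Relations 1, DfnSet (cardinalityQuantifier.{w} S) (n := 0)
      fun (M : BrModel.{0, 0, w} hartigVocab) _ a =>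
        FirstOrder.Language.Structure.RelMap R ![a] := fun R =>
    ⟨.rel R fun _ => .var 0, fun M e => by
      simp only [Formula.Realize, FirstOrder.Language.Term.realize_var]
      rw [show (![e (Fin.last 0)] : Fin 1 → M.carrier) = fun _ => e 0 from
        funext fun i => by fin_cases i; rfl]⟩
  obtain ⟨φ, hφ⟩ := hS.dfn_cnt_eq (hset HartigRel.U) (hset HartigRel.V)
  exact ⟨φ, fun M => hφ M Fin.elim0⟩

end DefinableRelations
end CardQuant

theorem mainTheorem7 (S : Set ℕ) (hS : CardQuant.Pseudoloose S) :
    CardQuant.NonPeriodicityCondition S ∧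
      CardQuant.AtMostAsStrong.{u, v, w} CardQuant.hartigQuantifier.{w}
        (CardQuant.cardinalityQuantifier.{w} S) ∧
      CardQuant.QuantifierDefinableIn CardQuant.hartigQuantifier.{w}
        (CardQuant.cardinalityQuantifier.{w} S) :=
  have h := hS.nonPeriodicityCondition
  ⟨h, h.atMostAsStrong, h.quantifierDefinableIn⟩
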